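/- Let $k$ be an algebraically closed field of characteristic $p$, let $G$ be a finite group, and let $kG$ be its group algebra. For a finite-dimensional right $kG$-module $M$ put $$\phi_M := \inf\{\, r \ge 1 \mid \operatorname{Ext}^r_{kG}(M,M) \neq 0 \,\} \in \{1,2,3,\dots\}\cup\{\infty\},\qquad \inf\emptyset := \infty .$$ Then for every finite-dimensional right $kG$-module $M$ such that $p$ does not divide $\dim_k M$, $$\phi_M \le \phi_k ,$$ where $k$ denotes the trivial $kG$-module (the one-dimensional module on which every element of $G$ acts as the identity). -/

import Mathlib

open CategoryTheory

universe u

noncomputable section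

/-- For a ring `A` and a right `A`-module `M` (a module over `Aᵐᵒᵖ`), the infimum in `ℕ∞` of all
`r ≥ 1` with `Ext^r_A(M, M) ≠ 0`; it is `⊤` if there is no such `r`. -/
def extPhi (A : Type u) [Ring A] (M : ModuleCat.{u} Aᵐᵒᵖ) : ℕ∞ :=
  sInf ((fun r : ℕ => (r : ℕ∞)) '' {r : ℕ | 1 ≤ r ∧ Nontrivial (Abelian.Ext M M r)})

/-- The augmentation `k[G] → k`, `∑ a_g g ↦ ∑ a_g`, as a ring homomorphism on `k[G]ᵐᵒᵖ`. -/
def augmentationOp (k G : Type u) [Field k] [Group G] : (MonoidAlgebra k G)ᵐᵒᵖ →+* k :=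
  RingHom.fromOpposite (MonoidAlgebra.lift k k G (1 : G →* k)).toRingHom
    (fun _ _ => Commute.all _ _)

/-- The trivial right `k[G]`-module: the space `k`, on which every `g ∈ G` acts as the identity. -/
def trivialRightModule (k G : Type u) [Field k] [Group G] :
    ModuleCat.{u} (MonoidAlgebra k G)ᵐᵒᵖ :=
  (ModuleCat.restrictScalars (augmentationOp k G)).obj (ModuleCat.of k k)

end

section Ext

open Limits

namespace CategoryTheory.Abelian.Ext

universe w w' v v' u₁ u₂

variable {C : Type u₁} [Category.{v} C] [Abelian C] {D : Type u₂} [Category.{v'} D] [Abelian D]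

/-! Tensoring with `M` sends `Ext^r(k, k)` to `Ext^r(M, M)`; this map is injective when `dim M` is
nonzero in `k`, so every degree counted for `k` is counted for `M`. Indeed the coevaluation `k →
Hom_k(M, M ⊗ k)` followed by the trace is multiplication by `dim M`, hence the coevaluation is split
mono (`isSplitMono_coev`). Both `M ⊗ -` and `Hom_k(M, -)` are exact over a field, and the
coevaluation is natural on `Ext` (`comp_mk₀_app_eq`), so a class killed by `M ⊗ -` is zero. -/

lemma nontrivial_of_iso [HasExt.{w} C] {X Y : C} (e : X ≅ Y) {n : ℕ}
    (h : Nontrivial (Ext.{w} X X n)) : Nontrivial (Ext.{w} Y Y n) := by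
  obtain ⟨x, hx⟩ := exists_ne (0 : Ext.{w} X X n)
  refine ⟨(mk₀ e.inv).comp (x.comp (mk₀ e.hom) (add_zero n)) (zero_add n), 0, fun h0 => hx ?_⟩
  have h1 := congrArg (fun y => (mk₀ e.hom).comp (y.comp (mk₀ e.inv) (add_zero n)) (zero_add n)) h0
  simpa using h1

variable [HasExt.{w} C] [HasExt.{w'} D] [EnoughProjectives C]
  {F : C ⥤ D} {R : D ⥤ C} [F.Additive] [R.Additive]
  [PreservesFiniteLimits F] [PreservesFiniteColimits F]
  [PreservesFiniteLimits R] [PreservesFiniteColimits R]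

/-- The maps on `Ext` induced by exact functors are natural with respect to a natural
transformation from the identity to a composite of exact functors. -/
lemma comp_mk₀_app_eq (η : 𝟭 C ⟶ F ⋙ R) {n : ℕ} :
    ∀ {X Y : C} (x : Ext.{w} X Y n), x.comp (mk₀ (η.app Y)) (add_zero n) =
      (mk₀ (η.app X)).comp ((x.mapExactFunctor F).mapExactFunctor R) (zero_add n) := by
  induction n with
  | zero =>
    intro X Y x
    obtain ⟨f, rfl⟩ := (mk₀_bijective X Y).2 x
    have := η.naturality f
    dsimp at this
    simp [mapExactFunctor_mk₀, this]
  | succ n hn =>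
    intro X Y x
    -- Dimension shifting: a class of positive degree dies on a projective cover of `X` by an
    -- epimorphism, so it factors as the extension class of `S` times a class `y` of degree `n`.
    let S := ShortComplex.mk _ _ (kernel.condition (Projective.π X))
    have hS : S.ShortExact :=
      { exact := ShortComplex.exact_of_f_is_kernel _ (kernelIsKernel S.g) }
    obtain ⟨y, rfl⟩ := contravariant_sequence_exact₃ hS Y x (eq_zero_of_projective _)
      (add_comm 1 n)
    let f : S ⟶ (S.map F).map R :=
      { τ₁ := η.app _, τ₂ := η.app _, τ₃ := η.app _
        comm₁₂ := (η.naturality S.f).symm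
        comm₂₃ := (η.naturality S.g).symm }
    have hf := ShortComplex.ShortExact.extClass_naturality hS
      ((hS.map_of_exact F).map_of_exact R) f
    have he : (hS.extClass.mapExactFunctor F).mapExactFunctor R =
        ((hS.map_of_exact F).map_of_exact R).extClass := by
      rw [mapExactFunctor_extClass]
      exact mapExactFunctor_extClass R _
    rw [mapExactFunctor_comp, mapExactFunctor_comp, he, comp_assoc_of_third_deg_zero, hn,
      ← comp_assoc_of_second_deg_zero]
    refine (congrArg (fun z => Ext.comp z
      ((y.mapExactFunctor F).mapExactFunctor R) (add_comm 1 n)) hf).trans ?_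
    exact comp_assoc _ _ _ _ _ (by lia)

/-- If `F` kills `x`, naturality gives `x` followed by `η` equal to zero, and the retraction of `η`
recovers `x`. -/
lemma nontrivial_of_isSplitMono (η : 𝟭 C ⟶ F ⋙ R) {X : C} [IsSplitMono (η.app X)] {n : ℕ}
    (h : Nontrivial (Ext.{w} X X n)) : Nontrivial (Ext.{w'} (F.obj X) (F.obj X) n) := by
  obtain ⟨x, hx⟩ := exists_ne (0 : Ext.{w} X X n)
  refine ⟨x.mapExactFunctor F, 0, fun h0 => hx ?_⟩
  have h1 := comp_mk₀_app_eq η x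
  rw [h0, mapExactFunctor_zero, comp_zero] at h1
  have h2 := congrArg (fun y => y.comp (mk₀ (retraction (η.app X))) (add_zero n)) h1
  simpa using h2

end CategoryTheory.Abelian.Ext

end Ext

section Rep

open Limits MonoidalCategory

namespace Rep

variable {k G : Type u} [Field k] [Group G] (X : Rep.{u} k G)

instance tensorLeft_preservesFiniteColimits : PreservesFiniteColimits (tensorLeft X) :=
  have : PreservesColimitsOfSize.{0, 0} (tensorLeft X) :=
    (ihom.adjunction X).leftAdjoint_preservesColimits
  inferInstance

instance ihom_preservesFiniteLimits : PreservesFiniteLimits (ihom X) :=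
  have : PreservesLimitsOfSize.{0, 0} (ihom X) :=
    (ihom.adjunction X).rightAdjoint_preservesLimits
  inferInstance

instance ihom_additive : (ihom X).Additive :=
  (ihom.adjunction X).right_adjoint_additive

instance tensorLeft_preservesFiniteLimits : PreservesFiniteLimits (tensorLeft X) := by
  have : (tensorLeft X).PreservesMonomorphisms := ⟨fun {A B} f hf => by
    rw [mono_iff_injective] at hf ⊢
    exact Module.Flat.lTensor_preserves_injective_linearMap (M := X.V) f.hom.toLinearMap hf⟩
  have := (tensorLeft X).preservesHomology_of_preservesMonos_and_cokernels
  exact (tensorLeft X).preservesFiniteLimits_of_preservesHomology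

instance ihom_preservesFiniteColimits : PreservesFiniteColimits (ihom X) := by
  have : (ihom X).PreservesEpimorphisms := ⟨fun {A B} f hf => by
    rw [epi_iff_surjective] at hf ⊢
    intro (φ : X.V →ₗ[k] B.V)
    -- A merely `k`-linear section suffices: elements of the internal hom are all linear maps, not
    -- just equivariant ones.
    obtain ⟨s, hs⟩ := f.hom.toLinearMap.exists_rightInverse_of_surjective
      (LinearMap.range_eq_top.2 hf)
    refine ⟨(s ∘ₗ φ : X.V →ₗ[k] A.V), ?_⟩
    change f.hom.toLinearMap ∘ₗ s ∘ₗ φ = φ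
    rw [← LinearMap.comp_assoc, hs, LinearMap.id_comp]⟩
  have := (ihom X).preservesHomology_of_preservesEpis_and_kernels
  exact (ihom X).preservesFiniteColimits_of_preservesHomology

/-- The trace, as a morphism of representations `Hom(X, X ⊗ 𝟙) ⟶ 𝟙`. -/
noncomputable def traceHom : (ihom X).obj (X ⊗ 𝟙_ (Rep.{u} k G)) ⟶ 𝟙_ (Rep.{u} k G) :=
  Rep.ofHom (ρ := Representation.linHom X.ρ (X ⊗ 𝟙_ (Rep.{u} k G)).ρ)
    (σ := Representation.trivial k G k)
    ⟨LinearMap.trace k X.V ∘ₗ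
      LinearMap.llcomp k X.V (TensorProduct k X.V k) X.V (TensorProduct.rid k X.V).toLinearMap,
    fun g => by
      refine LinearMap.ext fun φ => ?_
      have h : (TensorProduct.rid k X.V).toLinearMap ∘ₗ
          (X.ρ.tprod (Representation.trivial k G k) g ∘ₗ φ ∘ₗ X.ρ g⁻¹) =
          (X.ρ g * ((TensorProduct.rid k X.V).toLinearMap ∘ₗ φ)) * X.ρ g⁻¹ := by
        have : (TensorProduct.rid k X.V).toLinearMap ∘ₗ
            X.ρ.tprod (Representation.trivial k G k) g =
            X.ρ g ∘ₗ (TensorProduct.rid k X.V).toLinearMap := by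
          ext x; simp
        rw [← LinearMap.comp_assoc, this]
        rfl
      change LinearMap.trace k X.V ((TensorProduct.rid k X.V).toLinearMap ∘ₗ
        (X.ρ.tprod (Representation.trivial k G k) g ∘ₗ φ ∘ₗ X.ρ g⁻¹)) =
        LinearMap.trace k X.V ((TensorProduct.rid k X.V).toLinearMap ∘ₗ φ)
      -- Invariance of the trace under conjugation.
      rw [h, LinearMap.trace_mul_comm, ← mul_assoc, ← map_mul, inv_mul_cancel, map_one, one_mul]⟩

lemma coev_comp_traceHom [FiniteDimensional k X.V] :
    (ihom.coev X).app (𝟙_ (Rep.{u} k G)) ≫ X.traceHom =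
    (Module.finrank k X.V : k) • 𝟙 _ := by
  refine Rep.hom_ext (Representation.IntertwiningMap.ext (LinearMap.ext_ring ?_))
  change LinearMap.trace k X.V ((TensorProduct.rid k X.V).toLinearMap ∘ₗ
    (TensorProduct.mk k X.V k).flip 1) = (Module.finrank k X.V : k) • (1 : k)
  have : (TensorProduct.rid k X.V).toLinearMap ∘ₗ (TensorProduct.mk k X.V k).flip 1 =
      LinearMap.id := by
    ext x; simp
  rw [this, LinearMap.trace_id, smul_eq_mul, mul_one]

lemma isSplitMono_coev [FiniteDimensional k X.V] (h : (Module.finrank k X.V : k) ≠ 0) :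
    IsSplitMono ((ihom.coev X).app (𝟙_ (Rep.{u} k G))) :=
  ⟨⟨(Module.finrank k X.V : k)⁻¹ • X.traceHom, by
    rw [Linear.comp_smul, coev_comp_traceHom, smul_smul, inv_mul_cancel₀ h, one_smul]⟩⟩

end Rep

end Rep

section GroupAlgebra

variable (k G : Type u) [Field k] [Group G]

/-- The algebra isomorphism `k[Gᵐᵒᵖ] ≃ k[G]ᵐᵒᵖ`. -/
noncomputable def monoidAlgebraOpEquiv :
    MonoidAlgebra k Gᵐᵒᵖ ≃+* (MonoidAlgebra k G)ᵐᵒᵖ :=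
  (MonoidAlgebra.mapRingEquiv Gᵐᵒᵖ (RingEquiv.toOpposite k)).trans
    MonoidAlgebra.opRingEquiv.symm

lemma monoidAlgebraOpEquiv_single (g : Gᵐᵒᵖ) (a : k) :
    monoidAlgebraOpEquiv k G (MonoidAlgebra.single g a) =
      MulOpposite.op (MonoidAlgebra.single g.unop a) := by
  simp [monoidAlgebraOpEquiv]

/-- Right `k[G]`-modules are equivalent to representations of `Gᵐᵒᵖ`. -/
noncomputable def rightModuleEquivRep :
    ModuleCat.{u} (MonoidAlgebra k G)ᵐᵒᵖ ≌ Rep.{u} k Gᵐᵒᵖ :=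
  (ModuleCat.restrictScalarsEquivalenceOfRingEquiv (monoidAlgebraOpEquiv k G)).trans
    Rep.equivalenceModuleMonoidAlgebra.symm

instance : (rightModuleEquivRep k G).functor.Additive :=
  Functor.additive_of_preserves_binary_products _

variable {k G}

/-- The identity map from a right `k[G]`-module to the space of the corresponding
representation. -/
noncomputable def rightModuleEquivRepAddEquiv (M : ModuleCat.{u} (MonoidAlgebra k G)ᵐᵒᵖ) :
    M ≃+ ((rightModuleEquivRep k G).functor.obj M).V :=
  AddEquiv.refl M

lemma rightModuleEquivRepAddEquiv_smul (M : ModuleCat.{u} (MonoidAlgebra k G)ᵐᵒᵖ) (c : k)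
    (m : M) :
    rightModuleEquivRepAddEquiv M (MulOpposite.op (MonoidAlgebra.single (1 : G) c) • m) =
      c • rightModuleEquivRepAddEquiv M m := by
  have h := monoidAlgebraOpEquiv_single k G 1 c
  rw [MulOpposite.unop_one] at h
  rw [← h]
  rfl

lemma rightModuleEquivRepAddEquiv_ρ (M : ModuleCat.{u} (MonoidAlgebra k G)ᵐᵒᵖ) (g : Gᵐᵒᵖ)
    (m : M) :
    rightModuleEquivRepAddEquiv M (MulOpposite.op (MonoidAlgebra.single g.unop (1 : k)) • m) =
      ((rightModuleEquivRep k G).functor.obj M).ρ g (rightModuleEquivRepAddEquiv M m) := by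
  rw [← monoidAlgebraOpEquiv_single k G g 1]
  rfl

open MonoidalCategory

variable (k G) in
/-- The trivial right module corresponds to the trivial representation. -/
noncomputable def rightModuleEquivRepTrivialIso :
    (rightModuleEquivRep k G).functor.obj (trivialRightModule k G) ≅ 𝟙_ (Rep.{u} k Gᵐᵒᵖ) :=
  (Rep.mkIso (ρ := Representation.trivial k Gᵐᵒᵖ k)
    (σ := ((rightModuleEquivRep k G).functor.obj (trivialRightModule k G)).ρ)
    (.mk
      { rightModuleEquivRepAddEquiv (trivialRightModule k G) with
        map_smul' := fun c x => by
          refine Eq.trans ?_ (rightModuleEquivRepAddEquiv_smul (trivialRightModule k G) c x)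
          refine congrArg (rightModuleEquivRepAddEquiv (trivialRightModule k G)) ?_
          change c * x = augmentationOp k G _ * x
          simp [augmentationOp] }
      fun g => by
        refine LinearMap.ext fun x => ?_
        refine Eq.trans ?_ (rightModuleEquivRepAddEquiv_ρ (trivialRightModule k G) g x)
        refine congrArg (rightModuleEquivRepAddEquiv (trivialRightModule k G)) ?_
        change x = augmentationOp k G _ * x
        simp [augmentationOp])).symm

section Dimension

variable (k G) (M : Type u) [AddCommGroup M] [Module k M] [Module (MonoidAlgebra k G)ᵐᵒᵖ M]
  [IsScalarTower k (MonoidAlgebra k G)ᵐᵒᵖ M]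

/-- A right `k[G]`-module and the corresponding representation have the same underlying vector
space. -/
noncomputable def rightModuleEquivRepLinearEquiv :
    M ≃ₗ[k] ((rightModuleEquivRep k G).functor.obj (ModuleCat.of (MonoidAlgebra k G)ᵐᵒᵖ M)).V :=
  { rightModuleEquivRepAddEquiv (ModuleCat.of (MonoidAlgebra k G)ᵐᵒᵖ M) with
    map_smul' := fun c m => by
      refine Eq.trans ?_ (rightModuleEquivRepAddEquiv_smul (ModuleCat.of _ M) c m)
      refine congrArg (rightModuleEquivRepAddEquiv (ModuleCat.of _ M)) ?_
      have : MulOpposite.op (MonoidAlgebra.single (1 : G) c) =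
          c • (1 : (MonoidAlgebra k G)ᵐᵒᵖ) := by
        rw [← MulOpposite.op_one, ← MulOpposite.op_smul, MonoidAlgebra.one_def,
          MonoidAlgebra.smul_single, smul_eq_mul, mul_one]
      change c • m = MulOpposite.op (MonoidAlgebra.single (1 : G) c) • m
      rw [this, smul_assoc, one_smul] }

end Dimension

end GroupAlgebra

section Main

open MonoidalCategory

variable {k G : Type u} [Field k] [Group G]

lemma nontrivial_ext_self_of_nontrivial_ext_trivial
    (M : Type u) [AddCommGroup M] [Module k M] [Module (MonoidAlgebra k G)ᵐᵒᵖ M]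
    [IsScalarTower k (MonoidAlgebra k G)ᵐᵒᵖ M] [FiniteDimensional k M]
    (hM : (Module.finrank k M : k) ≠ 0) {r : ℕ}
    (h : Nontrivial (Abelian.Ext (trivialRightModule k G) (trivialRightModule k G) r)) :
    Nontrivial (Abelian.Ext (ModuleCat.of (MonoidAlgebra k G)ᵐᵒᵖ M)
      (ModuleCat.of (MonoidAlgebra k G)ᵐᵒᵖ M) r) := by
  have : HasExt.{u} (Rep.{u} k Gᵐᵒᵖ) := hasExt_of_enoughProjectives _
  let E := rightModuleEquivRep k G
  let X := E.functor.obj (ModuleCat.of (MonoidAlgebra k G)ᵐᵒᵖ M)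
  let e := rightModuleEquivRepLinearEquiv k G M
  have : FiniteDimensional k X.V := Module.Finite.equiv e
  have : IsSplitMono ((ihom.coev X).app (𝟙_ (Rep.{u} k Gᵐᵒᵖ))) :=
    X.isSplitMono_coev (by rwa [← e.finrank_eq])
  have : E.symm.functor.Additive := inferInstanceAs E.inverse.Additive
  have : E.symm.inverse.Additive := inferInstanceAs E.functor.Additive
  -- The unit of an equivalence is invertible, so the same lemma also moves `Ext` between modules
  -- and representations.
  have h₁ := Abelian.Ext.nontrivial_of_isSplitMono.{u, u} E.unit h
  have h₂ := Abelian.Ext.nontrivial_of_iso (rightModuleEquivRepTrivialIso k G) h₁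
  have h₃ := Abelian.Ext.nontrivial_of_isSplitMono.{u, u} (ihom.coev X) h₂
  have h₄ := Abelian.Ext.nontrivial_of_iso (ρ_ X) h₃
  have h₅ := Abelian.Ext.nontrivial_of_isSplitMono.{u, u} E.symm.unit h₄
  exact Abelian.Ext.nontrivial_of_iso (E.unitIso.app _).symm h₅

end Main

theorem mainTheorem10 {k G : Type u} [Field k] [IsAlgClosed k] (p : ℕ) [CharP k p]
    [Group G] [Finite G]
    (M : Type u) [AddCommGroup M] [Module k M] [Module (MonoidAlgebra k G)ᵐᵒᵖ M]
    [IsScalarTower k (MonoidAlgebra k G)ᵐᵒᵖ M] [FiniteDimensional k M]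
    (hM : ¬ p ∣ Module.finrank k M) :
    extPhi (MonoidAlgebra k G) (ModuleCat.of (MonoidAlgebra k G)ᵐᵒᵖ M) ≤
      extPhi (MonoidAlgebra k G) (trivialRightModule k G) := by
  refine sInf_le_sInf (Set.image_mono fun r hr => ⟨hr.1, ?_⟩)
  exact nontrivial_ext_self_of_nontrivial_ext_trivial M
    (fun h => hM ((CharP.cast_eq_zero_iff k p _).1 h)) hr.2
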